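/- Let $(\bar M,\bar J,\bar g)$ be an almost Hermitian manifold, i.e. a Riemannian manifold with a smooth $(1,1)$-tensor $\bar J$ such that $\bar J^2=-\mathrm{id}$ and $\bar g(\bar JX,\bar JY)=\bar g(X,Y)$. Let $(M^{d+l},g)$, $d,l>0$, be a CR-submanifold of $\bar M$, i.e. a smooth isometrically immersed manifold of dimension $d+l$ for which the distribution $D=\bar J(TM)\cap TM$ has constant real dimension $d$; let $D^\bot$ be the orthogonal complement of $D$ in $TM$. Let $h$ be the second fundamental form of $M$ in $\bar M$, and for a subspace $V\subset T_xM$ put $H_V=\sum_i h(e_i,e_i)$, where $(e_i)$ is an orthonormal basis of $V$; write $H=H_{T_xM}$. For mutually orthogonal subspaces $V,W$ of a tangent space of a Riemannian manifold, the mutual curvature is ${\rm S}_{\rm m}(V,W)=\sum_{a,b}g(R_{e_a,e_b}e_b,e_a)$, the sum of the sectional curvatures $K(e_a,e_b)$ over orthonormal bases $(e_a)$ of $V$ and $(e_b)$ of $W$; quantities computed with the curvature of $\bar M$ carry a bar. For $y\in\bar M$ put $\bar\delta^+_{\rm m}(d,l)(y)=\max\bar{\rm S}_{\rm m}(V,W)$,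 the maximum (which is attained) over all mutually orthogonal subspaces $V,W\subset T_y\bar M$ with $\dim V=d$, $\dim W=l$. Then at every point $x\in M$ the mixed scalar curvature satisfies $${\rm S}_{\rm m}(D,D^\bot)\ \le\ \tfrac14\,\|H\|^2+\bar\delta^+_{\rm m}(d,l).$$ Equality holds at $x\in M$ if and only if $M$ is mixed totally geodesic at $x$ (that is, $h(X,Y)=0$ for all $X\in D_x$, $Y\in D^\bot_x$), $H_D(x)=H_{D^\bot}(x)$, and $\bar{\rm S}_{\rm m}(D_x,D^\bot_x)=\bar\delta^+_{\rm m}(d,l)(x)$. -/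

import Mathlib

open Bundle
open scoped Manifold ContDiff InnerProductSpace

noncomputable section

namespace CRGeom

/-! ### The Levi-Civita connection and the curvature of a metric on a vector space

Here `G : E → E →L[ℝ] E →L[ℝ] ℝ` is a (coordinate expression of a) Riemannian metric. -/

section Coordinates

variable {E : Type*} [NormedAddCommGroup E] [NormedSpace ℝ E]

/-- Christoffel symbols of the Levi-Civita connection of `G` at `y`: the vector `Γ_y(u, v)` with
`2 G(Γ(u, v), w) = (D_u G)(v, w) + (D_v G)(u, w) - (D_w G)(u, v)` for all `w`. -/
def christoffel (G : E → E →L[ℝ] E →L[ℝ] ℝ) (y u v : E) : E :=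
  (1 / 2 : ℝ) • (G y).inverse
    (fderiv ℝ G y u v + fderiv ℝ G y v u - ((fderiv ℝ G y).flip u).flip v)

/-- The curvature tensor `R_{u, v} w = ∇_u ∇_v w - ∇_v ∇_u w - ∇_{[u, v]} w` at `y`, computed on
constant vector fields `u, v, w` (so that `[u, v] = 0`). -/
def coordCurvature (G : E → E →L[ℝ] E →L[ℝ] ℝ) (y u v w : E) : E :=
  fderiv ℝ (fun z => christoffel G z v w) y u - fderiv ℝ (fun z => christoffel G z u w) y v
    + christoffel G y u (christoffel G y v w) - christoffel G y v (christoffel G y u w)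

end Coordinates

/-! ### Riemannian manifolds

Riemannian manifolds are modelled on a finite-dimensional space `E` and the inner products on their
tangent spaces are given by Mathlib's `RiemannianBundle`. A tangent vector at `x` is, in Mathlib,
identified with the vector of its coordinates in the preferred chart at `x`. -/

section Riemannian

variable {E : Type*} [NormedAddCommGroup E] [NormedSpace ℝ E]
  {M : Type*} [TopologicalSpace M] [ChartedSpace E M]

instance instFiniteDimensionalTangentSpace [FiniteDimensional ℝ E] (x : M) :
    FiniteDimensional ℝ (TangentSpace 𝓘(ℝ, E) x) :=
  inferInstanceAs (FiniteDimensional ℝ E)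

variable [RiemannianBundle (fun x : M => TangentSpace 𝓘(ℝ, E) x)]

variable (E) in
/-- The Riemannian metric of `M` read in the preferred chart `φ` at `x`: at a point `y` of the
chart domain, `(v, w) ↦ ⟪dφ⁻¹ v, dφ⁻¹ w⟫`. -/
def coordMetric (x : M) (y : E) : E →L[ℝ] E →L[ℝ] ℝ :=
  let A : E →L[ℝ] TangentSpace 𝓘(ℝ, E) ((extChartAt 𝓘(ℝ, E) x).symm y) :=
    mfderiv 𝓘(ℝ, E) 𝓘(ℝ, E) (extChartAt 𝓘(ℝ, E) x).symm y
  (innerSL ℝ (E := TangentSpace 𝓘(ℝ, E) ((extChartAt 𝓘(ℝ, E) x).symm y))).bilinearComp A A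

/-- The Riemann curvature tensor of `M` at `x`. -/
def curvature (x : M) (u v w : TangentSpace 𝓘(ℝ, E) x) : TangentSpace 𝓘(ℝ, E) x :=
  coordCurvature (E := E) (coordMetric E x) (extChartAt 𝓘(ℝ, E) x x) u v w

variable [FiniteDimensional ℝ E]

/-- The mutual curvature `S_m(V, W) = ∑_{a, b} ⟪R_{e_a, e_b} e_b, e_a⟫` of two subspaces of a
tangent space, where `e_a`, `e_b` run over orthonormal bases of `V` and `W`. -/
def mutualCurvature {x : M} (V W : Submodule ℝ (TangentSpace 𝓘(ℝ, E) x)) : ℝ :=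
  ∑ a, ∑ b, ⟪curvature x (stdOrthonormalBasis ℝ V a : TangentSpace 𝓘(ℝ, E) x)
    (stdOrthonormalBasis ℝ W b) (stdOrthonormalBasis ℝ W b), stdOrthonormalBasis ℝ V a⟫_ℝ

variable (E) in
/-- The values `S_m(V, W)`, for `V, W` mutually orthogonal subspaces of the tangent space at `x`
of dimensions `m` and `n`. -/
def mutualCurvatureValues (m n : ℕ) (x : M) : Set ℝ :=
  {s | ∃ V W : Submodule ℝ (TangentSpace 𝓘(ℝ, E) x), V ⟂ W ∧ Module.finrank ℝ V = m ∧
    Module.finrank ℝ W = n ∧ mutualCurvature V W = s}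

variable (E) in
/-- The mutual curvature invariant `δ⁺_m(m, n)(x)`, the maximum of `S_m(V, W)` over mutually
orthogonal subspaces of dimensions `m` and `n`. -/
def deltaPlus (m n : ℕ) (x : M) : ℝ :=
  sSup (mutualCurvatureValues E m n x)

end Riemannian

/-! ### Almost Hermitian manifolds and CR-submanifolds -/

section Submanifold

variable {E : Type*} [NormedAddCommGroup E] [NormedSpace ℝ E]
  {M : Type*} [TopologicalSpace M] [ChartedSpace E M]
  {E' : Type*} [NormedAddCommGroup E'] [NormedSpace ℝ E']
  {N : Type*} [TopologicalSpace N] [ChartedSpace E' N] [IsManifold 𝓘(ℝ, E') ∞ N]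
  [RiemannianBundle (fun y : N => TangentSpace 𝓘(ℝ, E') y)]

variable (E' N) in
/-- An almost Hermitian structure on a Riemannian manifold `N`: a smooth `(1,1)`-tensor `J` with
`J² = -1` and `⟪J v, J w⟫ = ⟪v, w⟫` (so that `J` is skew-symmetric). -/
structure AlmostHermitian where
  /-- the `(1,1)`-tensor -/
  J : ∀ y : N, TangentSpace 𝓘(ℝ, E') y →L[ℝ] TangentSpace 𝓘(ℝ, E') y
  contMDiff_J : ContMDiff 𝓘(ℝ, E') (𝓘(ℝ, E').prod 𝓘(ℝ, E' →L[ℝ] E')) ∞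
    (fun y => TotalSpace.mk' (E' →L[ℝ] E')
      (E := fun y : N => TangentSpace 𝓘(ℝ, E') y →L[ℝ] TangentSpace 𝓘(ℝ, E') y) y (J y))
  J_J : ∀ (y : N) (v : TangentSpace 𝓘(ℝ, E') y), J y (J y v) = -v
  inner_J_J : ∀ (y : N) (v w : TangentSpace 𝓘(ℝ, E') y), ⟪J y v, J y w⟫_ℝ = ⟪v, w⟫_ℝ

variable (E E') in
/-- The differential of `f` at `x`, as a linear map. -/
def differential (f : M → N) (x : M) :
    TangentSpace 𝓘(ℝ, E) x →ₗ[ℝ] TangentSpace 𝓘(ℝ, E') (f x) :=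
  (mfderiv 𝓘(ℝ, E) 𝓘(ℝ, E') f x).toLinearMap

variable (E) in
/-- The complex distribution `D = J(TM) ∩ TM` of an immersed manifold, as a subspace of `T_x M`. -/
def complexDistribution (J : AlmostHermitian E' N) (f : M → N) (x : M) :
    Submodule ℝ (TangentSpace 𝓘(ℝ, E) x) :=
  ((LinearMap.range (differential E E' f x)).map (J.J (f x)).toLinearMap ⊓
    LinearMap.range (differential E E' f x)).comap (differential E E' f x)

variable [RiemannianBundle (fun x : M => TangentSpace 𝓘(ℝ, E) x)]

variable (E) in
/-- `f : M → N` exhibits the Riemannian manifold `M`, of dimension `d + l` with `d, l > 0`, as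
a CR-submanifold of the almost Hermitian manifold `N`: it is a smooth isometric immersion, and the
distribution `J(TM) ∩ TM` has constant real dimension `d`. -/
structure IsCRSubmanifold (J : AlmostHermitian E' N) (f : M → N) (d l : ℕ) : Prop where
  pos_left : 0 < d
  pos_right : 0 < l
  finrank_model : Module.finrank ℝ E = d + l
  contMDiff : ContMDiff 𝓘(ℝ, E) 𝓘(ℝ, E') ∞ f
  isometric : ∀ (x : M) (v w : TangentSpace 𝓘(ℝ, E) x),
    ⟪differential E E' f x v, differential E E' f x w⟫_ℝ = ⟪v, w⟫_ℝ
  finrank_complexDistribution : ∀ x, Module.finrank ℝ (complexDistribution E J f x) = d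

variable (E E') in
/-- The second fundamental form `h` of `f` at `x`, given by the Gauss formula
`h(X, Y) = ∇'_X Y - ∇_X Y`, where `∇'` and `∇` are the Levi-Civita connections of the ambient
manifold and of `M`, and `Y` is extended with constant coordinates. Thus, in the preferred charts
at `x` and `f x`, `h(X, Y) = D²f(X, Y) + Γ'(df X, df Y) - df (Γ(X, Y))`. -/
def secondFundamentalForm (f : M → N) (x : M) (X Y : TangentSpace 𝓘(ℝ, E) x) :
    TangentSpace 𝓘(ℝ, E') (f x) :=
  let ambient : E' :=
    fderiv ℝ (E := E) (fderiv ℝ (E := E) (F := E') (writtenInExtChartAt 𝓘(ℝ, E) 𝓘(ℝ, E') x f))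
        (extChartAt 𝓘(ℝ, E) x x) X Y
      + christoffel (E := E') (coordMetric E' (f x)) (extChartAt 𝓘(ℝ, E') (f x) (f x))
        (differential E E' f x X) (differential E E' f x Y)
  let tangential : E' :=
    differential E E' f x (christoffel (E := E) (coordMetric E x) (extChartAt 𝓘(ℝ, E) x x) X Y)
  ambient - tangential

variable (E E') in
/-- The mean curvature vector `H_V = ∑ h(e_i, e_i)` of a subspace `V` of `T_x M`, where `e_i` runs
over an orthonormal basis of `V` (a trace, not divided by the dimension). -/
def meanCurvature [FiniteDimensional ℝ E] (f : M → N) (x : M)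
    (V : Submodule ℝ (TangentSpace 𝓘(ℝ, E) x)) : TangentSpace 𝓘(ℝ, E') (f x) :=
  ∑ i, secondFundamentalForm E E' f x (stdOrthonormalBasis ℝ V i : TangentSpace 𝓘(ℝ, E) x)
    (stdOrthonormalBasis ℝ V i)

end Submanifold

end CRGeom

end

/-! The Gauss equation expresses each mixed sectional curvature of `M` as the ambient one plus
`⟪h(a,a), h(b,b)⟫ - ‖h(a,b)‖²`. Summing over orthonormal bases of `D` and `Dᗮ` gives S_m(D, Dᗮ) =
S̄_m(df D, df Dᗮ) + ⟪H_D, H_Dᗮ⟫ - ∑ ‖h(e_a, e_b)‖². Since H = H_D + H_Dᗮ, polarization turns the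
inner product into ¼‖H‖² - ¼‖H_D - H_Dᗮ‖². Bounding S̄_m by its maximum and dropping the two
negative squares gives the inequality; equality holds exactly when all three losses vanish.

The geometric input is the Gauss equation, proved in coordinates (`IsIsometricAt.gauss_equation`) by
differentiating the orthogonality of `h` to the tangent space, and moved to the manifold through the
preferred charts (`coordMetric_self`, `isIsometricAt_writtenInExtChartAt`). The rest is linear
algebra on one tangent space (`mutualSum_gauss`, `mutualSum_le_and_eq_iff`). The maximum is attained
because orthonormal frames form a compact set (`isGreatest_mutualSum`). -/

set_option maxSynthPendingDepth 3

noncomputable section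

namespace CRGeom

open Filter Topology

/-! ### Levi-Civita calculus of a metric in coordinates. -/

section Coordinates
variable {E : Type*} [NormedAddCommGroup E] [NormedSpace ℝ E]

/-- The Christoffel symbols, bundled as a continuous bilinear map. -/
def christoffelL (G : E → E →L[ℝ] E →L[ℝ] ℝ) (y : E) : E →L[ℝ] E →L[ℝ] E :=
  (1 / 2 : ℝ) • (ContinuousLinearMap.compL ℝ E (E →L[ℝ] ℝ) E (G y).inverse).comp
    (fderiv ℝ G y + (fderiv ℝ G y).flip -
      (ContinuousLinearMap.flipₗᵢ ℝ E E ℝ : (E →L[ℝ] E →L[ℝ] ℝ) →L[ℝ] _).comp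
        (fderiv ℝ G y).flip)

theorem christoffelL_apply (G : E → E →L[ℝ] E →L[ℝ] ℝ) (y u v : E) :
    christoffelL G y u v = christoffel G y u v := by
  simp only [christoffelL, christoffel]
  rfl

/-- `G` is of class `C²` and symmetric near `y`, and nondegenerate at `y`. -/
structure IsMetricAt (G : E → E →L[ℝ] E →L[ℝ] ℝ) (y : E) : Prop where
  contDiffAt : ContDiffAt ℝ 2 G y
  symm : ∀ᶠ z in 𝓝 y, ∀ v w, G z v w = G z w v
  isInvertible : (G y).IsInvertible

namespace IsMetricAt
variable {G : E → E →L[ℝ] E →L[ℝ] ℝ} {y : E}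

/-- Invertible operators form an open set, so nondegeneracy persists nearby. Identities valid at
such points may therefore be differentiated. -/
theorem eventually [CompleteSpace E] (h : IsMetricAt G y) : ∀ᶠ z in 𝓝 y, IsMetricAt G z := by
  have h1 := h.contDiffAt.eventually (by simp)
  have h2 := h.symm.eventually_nhds
  have h3 : ∀ᶠ z in 𝓝 y, (G z).IsInvertible := by
    obtain ⟨e, he⟩ := h.isInvertible
    have := h.contDiffAt.continuousAt.preimage_mem_nhds (he ▸ e.nhds)
    filter_upwards [this] with z ⟨e', he'⟩ using ⟨e', he'⟩
  filter_upwards [h1, h2, h3] with z a b c using ⟨a, b, c⟩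

theorem differentiableAt (h : IsMetricAt G y) : DifferentiableAt ℝ G y :=
  h.contDiffAt.differentiableAt (by simp)

theorem fderiv_symm (h : IsMetricAt G y) (u v w : E) :
    fderiv ℝ G y u v w = fderiv ℝ G y u w v := by
  have key : ∀ a b : E, HasFDerivAt (fun z => G z a b) (((fderiv ℝ G y).flip a).flip b) y := by
    intro a b
    exact ((h.differentiableAt.hasFDerivAt.clm_apply (hasFDerivAt_const a y)).clm_apply
      (hasFDerivAt_const b y)).congr_fderiv (by ext u; simp)
  have h1 : (fun z => G z v w) =ᶠ[𝓝 y] fun z => G z w v := by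
    filter_upwards [h.symm] with z hz using hz v w
  have := (key v w).unique ((key w v).congr_of_eventuallyEq h1)
  simpa using congr($this u)

theorem symm_self (h : IsMetricAt G y) (v w : E) : G y v w = G y w v :=
  h.symm.self_of_nhds v w

theorem koszul (h : IsMetricAt G y) (u v w : E) :
    G y (christoffelL G y u v) w =
      1 / 2 * (fderiv ℝ G y u v w + fderiv ℝ G y v u w - fderiv ℝ G y w u v) := by
  obtain ⟨e, he⟩ := h.isInvertible
  rw [christoffelL_apply, christoffel, ← he]
  simp

/-- Metric compatibility: in the sum of the two Koszul formulas everything but the derivative along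
`u` cancels. -/
theorem compatible (h : IsMetricAt G y) (u v w : E) :
    fderiv ℝ G y u v w =
      G y (christoffelL G y u v) w + G y v (christoffelL G y u w) := by
  rw [h.symm_self v, h.koszul, h.koszul, h.fderiv_symm u w v]
  ring

theorem christoffelL_symm (h : IsMetricAt G y) (u v : E) :
    christoffelL G y u v = christoffelL G y v u := by
  obtain ⟨e, he⟩ := h.isInvertible
  apply e.injective
  ext w
  have : ∀ a, e a = G y a := fun a => congr($he a)
  rw [this, this, h.koszul, h.koszul, h.fderiv_symm w u v]
  ring

/-- One derivative of `G` is used up by the Christoffel symbols and one remains; inversion of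
operators is smooth at invertible ones. -/
theorem differentiableAt_christoffelL [CompleteSpace E] (h : IsMetricAt G y) :
    DifferentiableAt ℝ (christoffelL G) y := by
  have hd : DifferentiableAt ℝ (fderiv ℝ G) y :=
    (h.contDiffAt.fderiv_right (m := 1) (by norm_num)).differentiableAt (by simp)
  have hi : DifferentiableAt ℝ (fun z => (G z).inverse) y :=
    ((h.isInvertible.contDiffAt_map_inverse (n := 1)).comp y
      (h.contDiffAt.of_le (by norm_num))).differentiableAt (by simp)
  have hf : DifferentiableAt ℝ (fun z => (fderiv ℝ G z).flip) y :=
    (ContinuousLinearMap.flipₗᵢ ℝ E E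
      (E →L[ℝ] ℝ)).toContinuousLinearEquiv.toContinuousLinearMap.differentiableAt.comp y hd
  let L' : (E →L[ℝ] E →L[ℝ] ℝ) →L[ℝ] (E →L[ℝ] E →L[ℝ] ℝ) :=
    (ContinuousLinearMap.flipₗᵢ ℝ E E ℝ).toContinuousLinearEquiv.toContinuousLinearMap
  have hs := (hd.add hf).sub ((differentiableAt_const L').clm_comp hf)
  exact ((((ContinuousLinearMap.compL ℝ E (E →L[ℝ] ℝ) E).differentiableAt.comp y hi).clm_comp
    hs).const_smul (1 / 2 : ℝ))

theorem coordCurvature_eq [CompleteSpace E] (h : IsMetricAt G y) (u v w : E) :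
    coordCurvature G y u v w = fderiv ℝ (christoffelL G) y u v w
      - fderiv ℝ (christoffelL G) y v u w
      + christoffelL G y u (christoffelL G y v w) - christoffelL G y v (christoffelL G y u w) := by
  have key : ∀ a b c : E, fderiv ℝ (fun z => christoffel G z a b) y c =
      fderiv ℝ (christoffelL G) y c a b := by
    intro a b c
    simp only [← christoffelL_apply]
    have := (h.differentiableAt_christoffelL.hasFDerivAt.clm_apply
      (hasFDerivAt_const a y)).clm_apply (hasFDerivAt_const b y)
    rw [this.fderiv]
    simp
  simp only [coordCurvature, key, christoffelL_apply]

end IsMetricAt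

/-! ### Second fundamental form and Gauss equation in coordinates. -/

section Gauss

variable {E' : Type*} [NormedAddCommGroup E'] [NormedSpace ℝ E']

/-- The second fundamental form of `F` in coordinates. -/
def coordSecondFundamentalForm (G : E → E →L[ℝ] E →L[ℝ] ℝ) (G' : E' → E' →L[ℝ] E' →L[ℝ] ℝ)
    (F : E → E') (y u v : E) : E' :=
  fderiv ℝ (fderiv ℝ F) y u v + christoffelL G' (F y) (fderiv ℝ F y u) (fderiv ℝ F y v)
    - fderiv ℝ F y (christoffelL G y u v)

/-- Near `y`, `F` is an isometric immersion of class `C³` between the metrics `G` and `G'`. -/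
structure IsIsometricAt (G : E → E →L[ℝ] E →L[ℝ] ℝ) (G' : E' → E' →L[ℝ] E' →L[ℝ] ℝ)
    (F : E → E') (y : E) : Prop where
  source : IsMetricAt G y
  target : IsMetricAt G' (F y)
  contDiffAt : ContDiffAt ℝ 3 F y
  isometric : ∀ᶠ z in 𝓝 y, ∀ v w, G' (F z) (fderiv ℝ F z v) (fderiv ℝ F z w) = G z v w

namespace IsIsometricAt

variable {G : E → E →L[ℝ] E →L[ℝ] ℝ} {G' : E' → E' →L[ℝ] E' →L[ℝ] ℝ} {F : E → E'} {y : E}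

theorem eventually [CompleteSpace E] [CompleteSpace E'] (h : IsIsometricAt G G' F y) :
    ∀ᶠ z in 𝓝 y, IsIsometricAt G G' F z := by
  filter_upwards [h.source.eventually, h.contDiffAt.continuousAt.eventually h.target.eventually,
    h.contDiffAt.eventually (by simp), h.isometric.eventually_nhds] with z a b c d
    using ⟨a, b, c, d⟩

theorem hasFDerivAt (h : IsIsometricAt G G' F y) : HasFDerivAt F (fderiv ℝ F y) y :=
  (h.contDiffAt.differentiableAt (by simp)).hasFDerivAt

theorem contDiffAt_fderiv (h : IsIsometricAt G G' F y) : ContDiffAt ℝ 2 (fderiv ℝ F) y :=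
  h.contDiffAt.fderiv_right (by norm_num)

theorem hasFDerivAt_fderiv (h : IsIsometricAt G G' F y) :
    HasFDerivAt (fderiv ℝ F) (fderiv ℝ (fderiv ℝ F) y) y :=
  (h.contDiffAt_fderiv.differentiableAt (by simp)).hasFDerivAt

theorem hasFDerivAt_fderiv_fderiv (h : IsIsometricAt G G' F y) :
    HasFDerivAt (fderiv ℝ (fderiv ℝ F)) (fderiv ℝ (fderiv ℝ (fderiv ℝ F)) y) y :=
  ((h.contDiffAt_fderiv.fderiv_right (m := 1) (by norm_num)).differentiableAt
    (by simp)).hasFDerivAt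

theorem second_symm (h : IsIsometricAt G G' F y) (u v : E) :
    fderiv ℝ (fderiv ℝ F) y u v = fderiv ℝ (fderiv ℝ F) y v u :=
  h.contDiffAt.isSymmSndFDerivAt (by rw [minSmoothness_of_isRCLikeNormedField]; norm_num) u v

/-- Cancels the third-order terms in the Gauss equation; this is why `F` is required to be C³. -/
theorem third_symm (h : IsIsometricAt G G' F y) (u v : E) :
    fderiv ℝ (fderiv ℝ (fderiv ℝ F)) y u v = fderiv ℝ (fderiv ℝ (fderiv ℝ F)) y v u :=
  h.contDiffAt_fderiv.isSymmSndFDerivAt (by simp) u v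

theorem isometric_self (h : IsIsometricAt G G' F y) (v w : E) :
    G' (F y) (fderiv ℝ F y v) (fderiv ℝ F y w) = G y v w :=
  h.isometric.self_of_nhds v w

/-- The Leibniz rule for `G'` along `F`, in terms of covariant derivatives. -/
theorem hasFDerivAt_metric [CompleteSpace E] [CompleteSpace E']
    (h : IsIsometricAt G G' F y) {X Y : E → E'} {X' Y' : E →L[ℝ] E'}
    (hX : HasFDerivAt X X' y) (hY : HasFDerivAt Y Y' y) (u : E) :
    fderiv ℝ (fun z => G' (F z) (X z) (Y z)) y u =
      G' (F y) (X' u + christoffelL G' (F y) (fderiv ℝ F y u) (X y)) (Y y) +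
      G' (F y) (X y) (Y' u + christoffelL G' (F y) (fderiv ℝ F y u) (Y y)) := by
  have := ((h.target.differentiableAt.hasFDerivAt.comp y h.hasFDerivAt).clm_apply hX).clm_apply hY
  rw [show (fun z => G' (F z) (X z) (Y z)) = fun z => (G' ∘ F) z (X z) (Y z) from rfl, this.fderiv]
  simp [h.target.compatible]
  ring

/-- The Leibniz rule applied to the fields `DF v` and `DF w`, whose product is `G v w` near `y` by
the isometry condition. -/
theorem fderiv_metric [CompleteSpace E] [CompleteSpace E']
    (h : IsIsometricAt G G' F y) (u v w : E) :
    fderiv ℝ G y u v w =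
      G' (F y) (fderiv ℝ (fderiv ℝ F) y u v +
        christoffelL G' (F y) (fderiv ℝ F y u) (fderiv ℝ F y v)) (fderiv ℝ F y w) +
      G' (F y) (fderiv ℝ F y v) (fderiv ℝ (fderiv ℝ F) y u w +
        christoffelL G' (F y) (fderiv ℝ F y u) (fderiv ℝ F y w)) := by
  have h1 : ∀ v, HasFDerivAt (fun z => fderiv ℝ F z v)
      ((fderiv ℝ (fderiv ℝ F) y).flip v) y := fun v =>
    (h.hasFDerivAt_fderiv.clm_apply (hasFDerivAt_const v y)).congr_fderiv (by ext; simp)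
  have h2 := h.hasFDerivAt_metric (h1 v) (h1 w) u
  simp only [ContinuousLinearMap.flip_apply] at h2
  rw [← h2]
  have h3 : (fun z => G' (F z) (fderiv ℝ F z v) (fderiv ℝ F z w)) =ᶠ[𝓝 y] fun z => G z v w := by
    filter_upwards [h.isometric] with z hz using hz v w
  rw [h3.fderiv_eq, ((h.source.differentiableAt.hasFDerivAt.clm_apply
    (hasFDerivAt_const v y)).clm_apply (hasFDerivAt_const w y)).fderiv]
  simp

/-- The second fundamental form is normal. -/
theorem secondFundamentalForm_normal [CompleteSpace E] [CompleteSpace E']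
    (h : IsIsometricAt G G' F y) (u v w : E) :
    G' (F y) (coordSecondFundamentalForm G G' F y u v) (fderiv ℝ F y w) = 0 := by
  -- With A(u, v) = D²F(u, v) + Γ'(DF u, DF v), the Koszul formula for `G` reduces by the symmetry
  -- of A to ⟪A(u, v), DF w⟫, which is the ambient term itself.
  rw [coordSecondFundamentalForm, map_sub, _root_.sub_apply, h.isometric_self,
    h.source.koszul, h.fderiv_metric, h.fderiv_metric, h.fderiv_metric]
  rw [h.second_symm v u, h.second_symm w u, h.second_symm w v,
    h.target.christoffelL_symm (fderiv ℝ F y v) (fderiv ℝ F y u),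
    h.target.christoffelL_symm (fderiv ℝ F y w) (fderiv ℝ F y u),
    h.target.christoffelL_symm (fderiv ℝ F y w) (fderiv ℝ F y v),
    h.target.symm_self (fderiv ℝ F y v), h.target.symm_self (fderiv ℝ F y u)]
  ring

/-- The **Gauss equation** in coordinates. -/
theorem gauss_equation [CompleteSpace E] [CompleteSpace E']
    (h : IsIsometricAt G G' F y) (u v w z : E) :
    G y (coordCurvature G y u v w) z =
      G' (F y) (coordCurvature G' (F y) (fderiv ℝ F y u) (fderiv ℝ F y v) (fderiv ℝ F y w))
        (fderiv ℝ F y z) +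
      G' (F y) (coordSecondFundamentalForm G G' F y u z)
        (coordSecondFundamentalForm G G' F y v w) -
      G' (F y) (coordSecondFundamentalForm G G' F y v z)
        (coordSecondFundamentalForm G G' F y u w) := by
  set D := fderiv ℝ F y with hD
  set D2 := fderiv ℝ (fderiv ℝ F) y with hD2
  set D3 := fderiv ℝ (fderiv ℝ (fderiv ℝ F)) y with hD3
  set C := christoffelL G y with hC
  set C' := christoffelL G' (F y) with hC'
  set B := coordSecondFundamentalForm G G' F with hB
  have hBy : ∀ a b, B y a b = D2 a b + C' (D a) (D b) - D (C a b) := fun a b => rfl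
  have h1 : ∀ v, HasFDerivAt (fun z => fderiv ℝ F z v) (D2.flip v) y := fun v =>
    (h.hasFDerivAt_fderiv.clm_apply (hasFDerivAt_const v y)).congr_fderiv (by ext; simp [hD2])
  -- The derivative of `z ↦ B z v w` at `y`, known only through its values.
  have h2 : ∀ v w, ∃ B' : E →L[ℝ] E', HasFDerivAt (fun z => B z v w) B' y ∧ ∀ u, B' u =
      D3 u v w + (fderiv ℝ (christoffelL G') (F y) (D u) (D v) (D w) + C' (D2 u v) (D w) +
        C' (D v) (D2 u w)) - (D2 u (C v w) + D (fderiv ℝ (christoffelL G) y u v w)) := by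
    intro v w
    have a1 := (h.hasFDerivAt_fderiv_fderiv.clm_apply (hasFDerivAt_const v y)).clm_apply
      (hasFDerivAt_const w y)
    have a2 := ((h.target.differentiableAt_christoffelL.hasFDerivAt.comp y
      h.hasFDerivAt).clm_apply (h1 v)).clm_apply (h1 w)
    have a3 := h.hasFDerivAt_fderiv.clm_apply
      ((h.source.differentiableAt_christoffelL.hasFDerivAt.clm_apply
        (hasFDerivAt_const v y)).clm_apply (hasFDerivAt_const w y))
    refine ⟨_, (a1.add a2).sub a3, fun u => ?_⟩
    simp [← hD, ← hD2, ← hD3, ← hC, ← hC']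
    abel
  -- Weingarten relation: differentiate ⟪B(b, c), DF d⟫ = 0 along `a`. The derivative of `DF d`
  -- splits into B(a, d) and a tangential part, which is orthogonal to B(b, c).
  have h3 : ∀ a b c d : E, ∀ B' : E →L[ℝ] E', HasFDerivAt (fun z => B z b c) B' y →
      G' (F y) (B' a + C' (D a) (B y b c)) (D d) = - G' (F y) (B y b c) (B y a d) := by
    intro a b c d B' hB'
    have e1 := h.hasFDerivAt_metric hB' (h1 d) a
    have e2 : (fun z => G' (F z) (B z b c) (fderiv ℝ F z d)) =ᶠ[𝓝 y] fun _ => 0 := by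
      filter_upwards [h.eventually] with z hz using hz.secondFundamentalForm_normal b c d
    rw [e2.fderiv_eq] at e1
    have e3 : D2 a d + C' (D a) (D d) = B y a d + D (C a d) := by rw [hBy]; abel
    simp only [ContinuousLinearMap.flip_apply, ← hD, ← hC', fderiv_fun_const, Pi.zero_apply,
      _root_.zero_apply, e3] at e1
    have e4 : G' (F y) (B y b c) (D (C a d)) = 0 := h.secondFundamentalForm_normal b c _
    rw [map_add (G' (F y) (B y b c)), e4] at e1
    linarith
  obtain ⟨Bv, hBv, hBv'⟩ := h2 v w
  obtain ⟨Bu, hBu, hBu'⟩ := h2 u w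
  have k1 := h3 u v w z Bv hBv
  have k2 := h3 v u w z Bu hBu
  -- The ambient curvature is the image of the intrinsic one, plus normal terms, plus an
  -- antisymmetrized covariant derivative of `B`. Pairing with `D z` kills the normal terms and
  -- turns the derivatives into products of `B`.
  have k3 : coordCurvature G' (F y) (D u) (D v) (D w) =
      D (coordCurvature G y u v w) + B y u (C v w) - B y v (C u w) +
      (Bv u + C' (D u) (B y v w)) - (Bu v + C' (D v) (B y u w)) := by
    rw [h.target.coordCurvature_eq, h.source.coordCurvature_eq, hBv', hBu']
    have s1 : D3 v u = D3 u v := h.third_symm v u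
    have s2 : D2 v u = D2 u v := h.second_symm v u
    have s3 : ∀ a b, C' a b = C' b a := h.target.christoffelL_symm
    simp only [hBy, map_sub, map_add, ← hC, ← hC', s1, s2]
    rw [s3 (D v) (D2 u w), s3 (D u) (D2 v w)]
    abel
  have n1 : G' (F y) (B y u (C v w)) (D z) = 0 := h.secondFundamentalForm_normal _ _ _
  have n2 : G' (F y) (B y v (C u w)) (D z) = 0 := h.secondFundamentalForm_normal _ _ _
  have n3 : G' (F y) (D (coordCurvature G y u v w)) (D z) = G y (coordCurvature G y u v w) z :=
    h.isometric_self _ _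
  rw [k3, map_sub, _root_.sub_apply, k2, map_add, _root_.add_apply, k1,
    map_sub, map_add, _root_.sub_apply, _root_.add_apply, n1, n2, n3,
    h.target.symm_self (B y u z), h.target.symm_self (B y v z)]
  ring

end IsIsometricAt
end Gauss
end Coordinates

/-! ### Orthonormal frames, traces and mutual curvature on an inner product space. -/

section LinearAlgebra

variable {T : Type*} [NormedAddCommGroup T] [InnerProductSpace ℝ T]
  {T' : Type*} [NormedAddCommGroup T'] [InnerProductSpace ℝ T']
  {ι κ : Type*}

/-- `b` is an orthonormal family that spans `V`. -/
def IsOrthonormalFrame (b : ι → T) (V : Submodule ℝ T) : Prop :=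
  Orthonormal ℝ b ∧ Submodule.span ℝ (Set.range b) = V

theorem isOrthonormalFrame_std (V : Submodule ℝ T) [FiniteDimensional ℝ V] :
    IsOrthonormalFrame (fun i => (stdOrthonormalBasis ℝ V i : T)) V := by
  refine ⟨(stdOrthonormalBasis ℝ V).orthonormal.comp_linearIsometry V.subtypeₗᵢ, ?_⟩
  have h := (stdOrthonormalBasis ℝ V).toBasis.span_eq
  have h2 := congrArg (Submodule.map V.subtype) h
  rw [Submodule.map_span, Submodule.map_subtype_top, ← Set.range_comp] at h2
  simpa [Function.comp_def] using h2

namespace IsOrthonormalFrame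

variable {b : ι → T} {c : κ → T} {V W : Submodule ℝ T}

theorem mem (hb : IsOrthonormalFrame b V) (i : ι) : b i ∈ V :=
  hb.2 ▸ Submodule.subset_span ⟨i, rfl⟩

theorem sum_inner_smul [Fintype ι] (hb : IsOrthonormalFrame b V) {v : T} (hv : v ∈ V) :
    ∑ i, ⟪b i, v⟫_ℝ • b i = v := by
  classical
  rw [← hb.2] at hv
  induction hv using Submodule.span_induction with
  | mem x hx =>
    obtain ⟨j, rfl⟩ := hx
    simp [orthonormal_iff_ite.1 hb.1]
  | zero => simp
  | add x y _ _ hx hy => simp [inner_add_right, add_smul, Finset.sum_add_distrib, hx, hy]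
  | smul a x _ hx => simp [inner_smul_right, mul_smul, ← Finset.smul_sum, hx]

/-- The trace of a bilinear map does not depend on the orthonormal frame. -/
theorem sum_apply_eq [Fintype ι] [Fintype κ] {F : Type*} [AddCommGroup F] [Module ℝ F]
    (hb : IsOrthonormalFrame b V)
    (hc : IsOrthonormalFrame c V) (B : T →ₗ[ℝ] T →ₗ[ℝ] F) :
    ∑ i, B (b i) (b i) = ∑ j, B (c j) (c j) := by
  -- Expanding one argument of each trace in the other frame gives the same double sum ∑ ⟪c_j, b_i⟫
  -- B(c_j, b_i).
  have h1 : ∀ i, B (b i) (b i) = ∑ j, ⟪c j, b i⟫_ℝ • B (c j) (b i) := fun i =>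
    (congrArg (fun t => B t (b i)) (hc.sum_inner_smul (hb.mem i))).symm.trans
      (by simp)
  have h2 : ∀ j, B (c j) (c j) = ∑ i, ⟪c j, b i⟫_ℝ • B (c j) (b i) := fun j =>
    (congrArg (B (c j)) (hb.sum_inner_smul (hc.mem j))).symm.trans (by simp [real_inner_comm])
  simp_rw [h1, h2]
  exact Finset.sum_comm

theorem map (hb : IsOrthonormalFrame b V) (L : T →ₗ[ℝ] T')
    (hL : ∀ v w, ⟪L v, L w⟫_ℝ = ⟪v, w⟫_ℝ) : IsOrthonormalFrame (fun i => L (b i)) (V.map L) := by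
  classical
  refine ⟨?_, ?_⟩
  · rw [orthonormal_iff_ite]
    simpa only [hL] using orthonormal_iff_ite.1 hb.1
  · rw [← hb.2, Submodule.map_span, ← Set.range_comp]
    rfl

theorem sumElim (hb : IsOrthonormalFrame b V) (hc : IsOrthonormalFrame c W) (hVW : V ⟂ W) :
    IsOrthonormalFrame (Sum.elim b c) (V ⊔ W) := by
  classical
  refine ⟨?_, ?_⟩
  · rw [orthonormal_iff_ite]
    have h1 := orthonormal_iff_ite.1 hb.1
    have h2 := orthonormal_iff_ite.1 hc.1
    have h3 := Submodule.isOrtho_iff_inner_eq.1 hVW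
    rintro (i | i) (j | j)
    · simp [h1]
    · simp [h3 _ (hb.mem i) _ (hc.mem j)]
    · simp [real_inner_comm, h3 _ (hb.mem j) _ (hc.mem i)]
    · simp [h2]
  · rw [Set.Sum.elim_range, Submodule.span_union, hb.2, hc.2]

theorem finrank_eq [Fintype ι] (hb : IsOrthonormalFrame b V) : Module.finrank ℝ V = Fintype.card ι := by
  rw [← hb.2]
  exact finrank_span_eq_card hb.1.linearIndependent

end IsOrthonormalFrame

variable [FiniteDimensional ℝ T] [FiniteDimensional ℝ T']

/-- The sum of `⟪R(e_a, e_b) e_b, e_a⟫` over orthonormal bases of two subspaces. -/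
def mutualSum (R : T →ₗ[ℝ] T →ₗ[ℝ] T →ₗ[ℝ] T) (V W : Submodule ℝ T) : ℝ :=
  ∑ a, ∑ b, ⟪R (stdOrthonormalBasis ℝ V a : T) (stdOrthonormalBasis ℝ W b : T)
    (stdOrthonormalBasis ℝ W b : T), (stdOrthonormalBasis ℝ V a : T)⟫_ℝ

/-- The sum of `B(e_i, e_i)` over an orthonormal basis of a subspace. -/
def traceOn {F : Type*} [AddCommGroup F] [Module ℝ F] (B : T →ₗ[ℝ] T →ₗ[ℝ] F)
    (V : Submodule ℝ T) : F :=
  ∑ i, B (stdOrthonormalBasis ℝ V i : T) (stdOrthonormalBasis ℝ V i : T)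

theorem traceOn_eq [Fintype ι] {F : Type*} [AddCommGroup F] [Module ℝ F] (B : T →ₗ[ℝ] T →ₗ[ℝ] F)
    {V : Submodule ℝ T} {b : ι → T} (hb : IsOrthonormalFrame b V) :
    traceOn B V = ∑ i, B (b i) (b i) :=
  (isOrthonormalFrame_std V).sum_apply_eq hb B

/-- With one argument pair fixed, the sum over the other is the trace of a bilinear form, so trace
invariance applies twice. -/
theorem mutualSum_eq [Fintype ι] [Fintype κ] (R : T →ₗ[ℝ] T →ₗ[ℝ] T →ₗ[ℝ] T) {V W : Submodule ℝ T}
    {b : ι → T} {c : κ → T} (hb : IsOrthonormalFrame b V) (hc : IsOrthonormalFrame c W) :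
    mutualSum R V W = ∑ i, ∑ j, ⟪R (b i) (c j) (c j), b i⟫_ℝ := by
  have h1 : ∀ a : T, ∑ j, ⟪R a (stdOrthonormalBasis ℝ W j : T)
      (stdOrthonormalBasis ℝ W j : T), a⟫_ℝ = ∑ j, ⟪R a (c j) (c j), a⟫_ℝ := fun a =>
    (isOrthonormalFrame_std W).sum_apply_eq hc ((R a).compr₂ ((innerₗ T).flip a))
  have h2 := (isOrthonormalFrame_std V).sum_apply_eq hb
    (∑ j, (innerₗ T) ∘ₗ ((LinearMap.applyₗ (c j)) ∘ₗ (R.flip (c j))))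
  simp only [mutualSum, h1]
  simpa using h2

theorem continuous_trilinear (R : T →ₗ[ℝ] T →ₗ[ℝ] T →ₗ[ℝ] T) :
    Continuous fun p : T × T × T => R p.1 p.2.1 p.2.2 := by
  let c := (LinearMap.toContinuousLinearMap (𝕜 := ℝ) (E := T) (F' := T))
  let c' := (LinearMap.toContinuousLinearMap (𝕜 := ℝ) (E := T) (F' := T →L[ℝ] T))
  let R' : T →L[ℝ] T →L[ℝ] T →L[ℝ] T :=
    LinearMap.toContinuousLinearMap (c'.toLinearMap ∘ₗ (R.compr₂ c.toLinearMap))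
  have : (fun p : T × T × T => R p.1 p.2.1 p.2.2) = fun p => R' p.1 p.2.1 p.2.2 := rfl
  rw [this]
  fun_prop

/-- The mutual curvature attains its supremum over orthogonal subspaces of given dimensions. -/
theorem isGreatest_mutualSum (R : T →ₗ[ℝ] T →ₗ[ℝ] T →ₗ[ℝ] T) (m n : ℕ)
    (hne : ∃ V W : Submodule ℝ T, V ⟂ W ∧ Module.finrank ℝ V = m ∧ Module.finrank ℝ W = n) :
    IsGreatest {s | ∃ V W : Submodule ℝ T, V ⟂ W ∧ Module.finrank ℝ V = m ∧
        Module.finrank ℝ W = n ∧ mutualSum R V W = s}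
      (sSup {s | ∃ V W : Submodule ℝ T, V ⟂ W ∧ Module.finrank ℝ V = m ∧
        Module.finrank ℝ W = n ∧ mutualSum R V W = s}) := by
  classical
  -- Admissible pairs of subspaces are parametrized by orthonormal (m + n)-frames, a compact set on
  -- which the mutual curvature is this continuous function.
  let φ : (Fin m ⊕ Fin n → T) → ℝ := fun c =>
    ∑ i, ∑ j, ⟪R (c (.inl i)) (c (.inr j)) (c (.inr j)), c (.inl i)⟫_ℝ
  have hφ : Continuous φ := by
    refine continuous_finsetSum _ fun i _ => continuous_finsetSum _ fun j _ =>
      Continuous.inner ?_ (continuous_apply _)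
    exact (continuous_trilinear R).comp (f := fun c : Fin m ⊕ Fin n → T =>
      (c (.inl i), c (.inr j), c (.inr j))) (by fun_prop)
  have hK : IsCompact {c : Fin m ⊕ Fin n → T | Orthonormal ℝ c} := by
    refine (isCompact_univ_pi fun _ => isCompact_closedBall (0 : T) 1).of_isClosed_subset ?_ ?_
    · simp only [orthonormal_iff_ite, Set.ofPred_forall]
      refine isClosed_iInter fun i => isClosed_iInter fun j => isClosed_eq ?_ continuous_const
      fun_prop
    · intro c hc i _
      simp [(hc : Orthonormal ℝ c).1 i]
  have hS : {s | ∃ V W : Submodule ℝ T, V ⟂ W ∧ Module.finrank ℝ V = m ∧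
      Module.finrank ℝ W = n ∧ mutualSum R V W = s} = φ '' {c | Orthonormal ℝ c} := by
    ext s
    constructor
    · rintro ⟨V, W, hVW, rfl, rfl, rfl⟩
      exact ⟨_, ((isOrthonormalFrame_std V).sumElim (isOrthonormalFrame_std W) hVW).1, rfl⟩
    · rintro ⟨c, hc, rfl⟩
      have h1 : IsOrthonormalFrame (fun i => c (.inl i)) _ :=
        ⟨(hc : Orthonormal ℝ c).comp _ Sum.inl_injective, rfl⟩
      have h2 : IsOrthonormalFrame (fun i => c (.inr i)) _ :=
        ⟨(hc : Orthonormal ℝ c).comp _ Sum.inr_injective, rfl⟩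
      refine ⟨_, _, ?_, by simpa using h1.finrank_eq, by simpa using h2.finrank_eq,
        mutualSum_eq R h1 h2⟩
      rw [Submodule.isOrtho_span]
      rintro _ ⟨i, rfl⟩ _ ⟨j, rfl⟩
      simp [orthonormal_iff_ite.1 hc]
  rw [hS]
  refine (hK.image hφ).isGreatest_sSup ?_
  rw [← hS]
  obtain ⟨V, W, h1, h2, h3⟩ := hne
  exact ⟨_, V, W, h1, h2, h3, rfl⟩

theorem traceOn_top {F : Type*} [AddCommGroup F] [Module ℝ F] (B : T →ₗ[ℝ] T →ₗ[ℝ] F)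
    (D : Submodule ℝ T) : traceOn B ⊤ = traceOn B D + traceOn B Dᗮ := by
  have h := (isOrthonormalFrame_std D).sumElim (isOrthonormalFrame_std Dᗮ)
    (Submodule.isOrtho_orthogonal_right D)
  rw [Submodule.sup_orthogonal_of_hasOrthogonalProjection] at h
  rw [traceOn_eq B h, Fintype.sum_sum_type]
  rfl

variable {R : T →ₗ[ℝ] T →ₗ[ℝ] T →ₗ[ℝ] T} {R' : T' →ₗ[ℝ] T' →ₗ[ℝ] T' →ₗ[ℝ] T'}
  {L : T →ₗ[ℝ] T'} {B : T →ₗ[ℝ] T →ₗ[ℝ] T'}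

/-- The traced Gauss equation. -/
theorem mutualSum_gauss (hL : ∀ v w, ⟪L v, L w⟫_ℝ = ⟪v, w⟫_ℝ) (hB : ∀ v w, B v w = B w v)
    (gauss : ∀ u v w z, ⟪R u v w, z⟫_ℝ =
      ⟪R' (L u) (L v) (L w), L z⟫_ℝ + ⟪B u z, B v w⟫_ℝ - ⟪B v z, B u w⟫_ℝ)
    (D : Submodule ℝ T) :
    mutualSum R D Dᗮ = mutualSum R' (D.map L) (Dᗮ.map L) + 1 / 4 * ‖traceOn B ⊤‖ ^ 2
      - 1 / 4 * ‖traceOn B D - traceOn B Dᗮ‖ ^ 2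
      - ∑ a, ∑ b, ‖B (stdOrthonormalBasis ℝ D a : T) (stdOrthonormalBasis ℝ Dᗮ b : T)‖ ^ 2 := by
  -- Polarization, 4⟪p, q⟫ = ‖p + q‖² - ‖p - q‖², is the source of the constant 1/4.
  have h1 : ⟪traceOn B D, traceOn B Dᗮ⟫_ℝ =
      1 / 4 * ‖traceOn B ⊤‖ ^ 2 - 1 / 4 * ‖traceOn B D - traceOn B Dᗮ‖ ^ 2 := by
    rw [traceOn_top B D, norm_add_sq_real, norm_sub_sq_real]
    ring
  rw [add_sub_assoc, ← h1, mutualSum_eq R' ((isOrthonormalFrame_std D).map L hL)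
    ((isOrthonormalFrame_std Dᗮ).map L hL), mutualSum, traceOn, traceOn]
  simp only [sum_inner, inner_sum]
  rw [Finset.sum_comm (f := fun i j => ⟪B (stdOrthonormalBasis ℝ D j : T) _, _⟫_ℝ)]
  simp only [← Finset.sum_add_distrib, ← Finset.sum_sub_distrib]
  refine Finset.sum_congr rfl fun a _ => Finset.sum_congr rfl fun b _ => ?_
  rw [gauss, hB (stdOrthonormalBasis ℝ Dᗮ b : T) (stdOrthonormalBasis ℝ D a : T),
    real_inner_self_eq_norm_sq]

/-- The gap between the two sides is a sum of three nonnegative terms: `δ` minus the ambient mutual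
curvature, ¼‖H_D - H_Dᗮ‖², and the sum of mixed squares. It vanishes exactly when each term does. -/
theorem mutualSum_le_and_eq_iff (hL : ∀ v w, ⟪L v, L w⟫_ℝ = ⟪v, w⟫_ℝ)
    (hB : ∀ v w, B v w = B w v)
    (gauss : ∀ u v w z, ⟪R u v w, z⟫_ℝ =
      ⟪R' (L u) (L v) (L w), L z⟫_ℝ + ⟪B u z, B v w⟫_ℝ - ⟪B v z, B u w⟫_ℝ)
    (D : Submodule ℝ T) {δ : ℝ} (hδ : mutualSum R' (D.map L) (Dᗮ.map L) ≤ δ) :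
    mutualSum R D Dᗮ ≤ 1 / 4 * ‖traceOn B ⊤‖ ^ 2 + δ ∧
    (mutualSum R D Dᗮ = 1 / 4 * ‖traceOn B ⊤‖ ^ 2 + δ ↔
      (∀ X ∈ D, ∀ Y ∈ Dᗮ, B X Y = 0) ∧ traceOn B D = traceOn B Dᗮ ∧
        mutualSum R' (D.map L) (Dᗮ.map L) = δ) := by
  have key := mutualSum_gauss hL hB gauss D
  set S := ∑ a, ∑ b, ‖B (stdOrthonormalBasis ℝ D a : T) (stdOrthonormalBasis ℝ Dᗮ b : T)‖ ^ 2
    with hS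
  have hS0 : 0 ≤ S := Finset.sum_nonneg fun _ _ => Finset.sum_nonneg fun _ _ => by positivity
  have hH0 : 0 ≤ ‖traceOn B D - traceOn B Dᗮ‖ ^ 2 := by positivity
  have hSiff : S = 0 ↔ ∀ X ∈ D, ∀ Y ∈ Dᗮ, B X Y = 0 := by
    constructor
    · intro h0 X hX Y hY
      have h1 : ∀ a b, B (stdOrthonormalBasis ℝ D a : T) (stdOrthonormalBasis ℝ Dᗮ b : T) = 0 := by
        intro a b
        rw [hS, Finset.sum_eq_zero_iff_of_nonneg
          fun _ _ => Finset.sum_nonneg fun _ _ => by positivity] at h0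
        have := h0 a (Finset.mem_univ _)
        rw [Finset.sum_eq_zero_iff_of_nonneg fun _ _ => by positivity] at this
        simpa using this b (Finset.mem_univ _)
      rw [← (isOrthonormalFrame_std D).sum_inner_smul hX,
        ← (isOrthonormalFrame_std Dᗮ).sum_inner_smul hY]
      simp [h1]
    · intro h
      exact Finset.sum_eq_zero fun a _ => Finset.sum_eq_zero fun b _ => by
        rw [h _ (Submodule.coe_mem _) _ (Submodule.coe_mem _)]; simp
  have hHiff : ‖traceOn B D - traceOn B Dᗮ‖ ^ 2 = 0 ↔ traceOn B D = traceOn B Dᗮ := by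
    simp [sub_eq_zero]
  refine ⟨by linarith, ?_⟩
  rw [← hSiff, ← hHiff]
  constructor
  · intro h
    refine ⟨by linarith, by linarith, by linarith⟩
  · rintro ⟨h1, h2, h3⟩
    linarith

end LinearAlgebra

/-! ### The Riemannian metric and an isometric immersion read in charts. -/

section Charts

variable {E : Type*} [NormedAddCommGroup E] [NormedSpace ℝ E] [FiniteDimensional ℝ E]
  {M : Type*} [TopologicalSpace M] [ChartedSpace E M] [IsManifold 𝓘(ℝ, E) ∞ M]

omit [FiniteDimensional ℝ E] in
-- The coordinate field with constant coordinates `v` is the tangent map of the inverse chart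
-- applied to a constant field, hence smooth.
theorem contMDiffAt_extChartAt_symm_apply (x : M) {y : E} (hy : y ∈ (extChartAt 𝓘(ℝ, E) x).target)
    (v : E) : ContMDiffAt 𝓘(ℝ, E) 𝓘(ℝ, E).tangent ∞
      (fun z => (⟨(extChartAt 𝓘(ℝ, E) x).symm z,
        mfderiv 𝓘(ℝ, E) 𝓘(ℝ, E) (extChartAt 𝓘(ℝ, E) x).symm z v⟩ : TangentBundle 𝓘(ℝ, E) M)) y := by
  have ho : IsOpen (extChartAt 𝓘(ℝ, E) x).target := isOpen_extChartAt_target x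
  have h1 := (contMDiffOn_extChartAt_symm (n := ∞) (I := 𝓘(ℝ, E)) x).contMDiffOn_tangentMapWithin
    (m := ∞) (by simp) ho.uniqueMDiffOn
  have h2 : ContMDiff 𝓘(ℝ, E) 𝓘(ℝ, E).tangent ∞
      (fun z : E => (⟨z, v⟩ : TangentBundle 𝓘(ℝ, E) E)) := by
    exact contMDiff_vectorSpace_iff_contDiff.2 contDiff_const
  have h3 := h1.comp h2.contMDiffOn (s := (extChartAt 𝓘(ℝ, E) x).target) fun z hz => hz
  refine (h3.contMDiffAt (ho.mem_nhds hy)).congr_of_eventuallyEq ?_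
  filter_upwards [ho.mem_nhds hy] with z hz
  simp only [Function.comp_apply, tangentMapWithin]
  rw [mfderivWithin_of_isOpen ho hz]

variable [RiemannianBundle (fun x : M => TangentSpace 𝓘(ℝ, E) x)]

variable (E) in
/-- The inner product of the tangent space at `z`, on coordinate vectors. -/
def innerAt (z : M) (a b : E) : ℝ :=
  inner ℝ (E := TangentSpace 𝓘(ℝ, E) z) a b

omit [FiniteDimensional ℝ E] [IsManifold 𝓘(ℝ, E) ∞ M] in
theorem coordMetric_apply (x : M) (y v w : E) :
    coordMetric E x y v w = innerAt E ((extChartAt 𝓘(ℝ, E) x).symm y)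
      (mfderiv 𝓘(ℝ, E) 𝓘(ℝ, E) (extChartAt 𝓘(ℝ, E) x).symm y v)
      (mfderiv 𝓘(ℝ, E) 𝓘(ℝ, E) (extChartAt 𝓘(ℝ, E) x).symm y w) :=
  rfl

omit [FiniteDimensional ℝ E] in
-- Tangent vectors at `x` are identified with their coordinates in this very chart, so its inverse
-- has identity derivative at the centre.
theorem coordMetric_self (x : M) (v w : E) :
    coordMetric E x (extChartAt 𝓘(ℝ, E) x x) v w = innerAt E x v w := by
  have h1 := mfderivWithin_range_extChartAt_symm (I := 𝓘(ℝ, E)) (x := x)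
  simp only [modelWithCornersSelf_coe, Set.range_id, mfderivWithin_univ] at h1
  have h2 : ∀ a : E, (mfderiv 𝓘(ℝ, E) 𝓘(ℝ, E) (extChartAt 𝓘(ℝ, E) x).symm
      (extChartAt 𝓘(ℝ, E) x x) a : E) = a := fun a => congr($h1 a)
  rw [coordMetric_apply, extChartAt_to_inv]
  exact congrArg₂ (innerAt E x) (h2 v) (h2 w)

theorem contDiffAt_coordMetric
    [IsContMDiffRiemannianBundle 𝓘(ℝ, E) ∞ E (fun x : M => TangentSpace 𝓘(ℝ, E) x)]
    (x : M) {y : E} (hy : y ∈ (extChartAt 𝓘(ℝ, E) x).target) :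
    ContDiffAt ℝ ∞ (coordMetric E x) y := by
  have ho : IsOpen (extChartAt 𝓘(ℝ, E) x).target := isOpen_extChartAt_target x
  have h : ContDiffOn ℝ ∞ (coordMetric E x) (extChartAt 𝓘(ℝ, E) x).target := by
    rw [contDiffOn_clm_apply]
    intro v
    rw [contDiffOn_clm_apply]
    intro w z hz
    have := ContMDiffAt.inner_bundle (E := fun x : M => TangentSpace 𝓘(ℝ, E) x)
      (contMDiffAt_extChartAt_symm_apply x hz v) (contMDiffAt_extChartAt_symm_apply x hz w)
    exact this.contDiffAt.contDiffWithinAt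
  exact h.contDiffAt (ho.mem_nhds hy)

theorem isMetricAt_coordMetric
    [IsContMDiffRiemannianBundle 𝓘(ℝ, E) ∞ E (fun x : M => TangentSpace 𝓘(ℝ, E) x)] (x : M) :
    IsMetricAt (coordMetric E x) (extChartAt 𝓘(ℝ, E) x x) where
  contDiffAt := (contDiffAt_coordMetric x (mem_extChartAt_target x)).of_le (by norm_cast)
  symm := Eventually.of_forall fun z v w => by
    rw [coordMetric_apply, coordMetric_apply]
    exact real_inner_comm (F := TangentSpace 𝓘(ℝ, E) ((extChartAt 𝓘(ℝ, E) x).symm z)) _ _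
  isInvertible := by
    -- Positive definiteness gives injectivity into the dual, and equality of dimensions gives the
    -- inverse.
    have hinj : Function.Injective (coordMetric E x (extChartAt 𝓘(ℝ, E) x x)).toLinearMap := by
      rw [← LinearMap.ker_eq_bot, LinearMap.ker_eq_bot']
      intro v hv
      have := coordMetric_self x v v
      rw [show coordMetric E x (extChartAt 𝓘(ℝ, E) x x) v = 0 from hv] at this
      exact (inner_self_eq_zero (𝕜 := ℝ) (E := TangentSpace 𝓘(ℝ, E) x)).1 this.symm
    have hfr : Module.finrank ℝ E = Module.finrank ℝ (E →L[ℝ] ℝ) := by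
      rw [← (LinearMap.toContinuousLinearMap (𝕜 := ℝ) (E := E) (F' := ℝ)).finrank_eq]
      exact (Subspace.dual_finrank_eq (K := ℝ) (V := E)).symm
    exact ⟨(LinearMap.linearEquivOfInjective _ hinj hfr).toContinuousLinearEquiv, by ext; rfl⟩

variable {E' : Type*} [NormedAddCommGroup E'] [NormedSpace ℝ E'] [FiniteDimensional ℝ E']
  {N : Type*} [TopologicalSpace N] [ChartedSpace E' N] [IsManifold 𝓘(ℝ, E') ∞ N]
  [RiemannianBundle (fun y : N => TangentSpace 𝓘(ℝ, E') y)]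

omit [FiniteDimensional ℝ E] [FiniteDimensional ℝ E'] [IsManifold 𝓘(ℝ, E) ∞ M]
  [IsManifold 𝓘(ℝ, E') ∞ N]
  [RiemannianBundle (fun x : M => TangentSpace 𝓘(ℝ, E) x)]
  [RiemannianBundle (fun y : N => TangentSpace 𝓘(ℝ, E') y)] in
theorem contDiffAt_writtenInExtChartAt {f : M → N} (hf : ContMDiff 𝓘(ℝ, E) 𝓘(ℝ, E') ∞ f) (x : M) :
    ContDiffAt ℝ ∞ (writtenInExtChartAt 𝓘(ℝ, E) 𝓘(ℝ, E') x f) (extChartAt 𝓘(ℝ, E) x x) := by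
  have := (contMDiffAt_iff.1 (hf x)).2
  rwa [modelWithCornersSelf_coe, Set.range_id, contDiffWithinAt_univ] at this

/-- The isometry condition is needed on a neighbourhood, since the Gauss equation differentiates it.
Where `f` lands in the target chart, ψ⁻¹ ∘ F = f ∘ φ⁻¹, and the chain rule on both sides reduces it
to the isometry of `f`. -/
theorem isIsometricAt_writtenInExtChartAt
    [IsContMDiffRiemannianBundle 𝓘(ℝ, E) ∞ E (fun x : M => TangentSpace 𝓘(ℝ, E) x)]
    [IsContMDiffRiemannianBundle 𝓘(ℝ, E') ∞ E' (fun y : N => TangentSpace 𝓘(ℝ, E') y)]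
    {f : M → N} (hf : ContMDiff 𝓘(ℝ, E) 𝓘(ℝ, E') ∞ f)
    (hiso : ∀ (x : M) (v w : TangentSpace 𝓘(ℝ, E) x),
      ⟪differential E E' f x v, differential E E' f x w⟫_ℝ = ⟪v, w⟫_ℝ) (x : M) :
    IsIsometricAt (coordMetric E x) (coordMetric E' (f x))
      (writtenInExtChartAt 𝓘(ℝ, E) 𝓘(ℝ, E') x f) (extChartAt 𝓘(ℝ, E) x x) where
  source := isMetricAt_coordMetric x
  target := by
    have : writtenInExtChartAt 𝓘(ℝ, E) 𝓘(ℝ, E') x f (extChartAt 𝓘(ℝ, E) x x) =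
      extChartAt 𝓘(ℝ, E') (f x) (f x) := by simp [writtenInExtChartAt]
    rw [this]
    exact isMetricAt_coordMetric (f x)
  contDiffAt := (contDiffAt_writtenInExtChartAt hf x).of_le (by norm_cast)
  isometric := by
    set φ := extChartAt 𝓘(ℝ, E) x with hφ
    set ψ := extChartAt 𝓘(ℝ, E') (f x) with hψ
    have ho : IsOpen φ.target := isOpen_extChartAt_target x
    have ho' : IsOpen ψ.target := isOpen_extChartAt_target (f x)
    have hc : ContinuousOn (f ∘ φ.symm) φ.target :=
      hf.continuous.comp_continuousOn (continuousOn_extChartAt_symm x)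
    have hU : IsOpen (φ.target ∩ (f ∘ φ.symm) ⁻¹' ψ.source) :=
      hc.isOpen_inter_preimage ho (isOpen_extChartAt_source (f x))
    have hx : φ x ∈ φ.target ∩ (f ∘ φ.symm) ⁻¹' ψ.source := by
      refine ⟨mem_extChartAt_target x, ?_⟩
      simp [hφ, hψ]
    filter_upwards [hU.mem_nhds hx] with z hz v w
    have hFz : writtenInExtChartAt 𝓘(ℝ, E) 𝓘(ℝ, E') x f z ∈ ψ.target := ψ.map_source hz.2
    have hinv : ψ.symm (writtenInExtChartAt 𝓘(ℝ, E) 𝓘(ℝ, E') x f z) = f (φ.symm z) :=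
      ψ.left_inv hz.2
    have e1 : MDifferentiableAt 𝓘(ℝ, E) 𝓘(ℝ, E) φ.symm z :=
      ((contMDiffOn_extChartAt_symm (n := ∞) (I := 𝓘(ℝ, E)) x).contMDiffAt
        (ho.mem_nhds hz.1)).mdifferentiableAt (by simp)
    have e2 : MDifferentiableAt 𝓘(ℝ, E') 𝓘(ℝ, E') ψ.symm
        (writtenInExtChartAt 𝓘(ℝ, E) 𝓘(ℝ, E') x f z) :=
      ((contMDiffOn_extChartAt_symm (n := ∞) (I := 𝓘(ℝ, E')) (f x)).contMDiffAt
        (ho'.mem_nhds hFz)).mdifferentiableAt (by simp)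
    have e3 : MDifferentiableAt 𝓘(ℝ, E) 𝓘(ℝ, E') f (φ.symm z) :=
      hf.mdifferentiable (by simp) _
    have e4 : MDifferentiableAt 𝓘(ℝ, E) 𝓘(ℝ, E')
        (writtenInExtChartAt 𝓘(ℝ, E) 𝓘(ℝ, E') x f) z :=
      (mdifferentiableAt_extChartAt (I := 𝓘(ℝ, E')) (x := f x) (y := f (φ.symm z))
        (by simpa [hψ] using hz.2)).comp z (e3.comp z e1)
    have heq : ψ.symm ∘ writtenInExtChartAt 𝓘(ℝ, E) 𝓘(ℝ, E') x f =ᶠ[𝓝 z] f ∘ φ.symm := by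
      filter_upwards [hU.mem_nhds hz] with z' hz' using ψ.left_inv hz'.2
    have c1 := mfderiv_comp z e2 e4
    have c2 := mfderiv_comp z e3 e1
    have c3 := heq.mfderiv_eq (I := 𝓘(ℝ, E)) (I' := 𝓘(ℝ, E'))
    have c4 : ∀ a : E, (mfderiv 𝓘(ℝ, E') 𝓘(ℝ, E') ψ.symm
        (writtenInExtChartAt 𝓘(ℝ, E) 𝓘(ℝ, E') x f z)
        (fderiv ℝ (writtenInExtChartAt 𝓘(ℝ, E) 𝓘(ℝ, E') x f) z a) : E') =
        mfderiv 𝓘(ℝ, E) 𝓘(ℝ, E') f (φ.symm z) (mfderiv 𝓘(ℝ, E) 𝓘(ℝ, E) φ.symm z a) := by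
      intro a
      have c5 : (mfderiv 𝓘(ℝ, E) 𝓘(ℝ, E')
        (ψ.symm ∘ writtenInExtChartAt 𝓘(ℝ, E) 𝓘(ℝ, E') x f) z a : E') =
        mfderiv 𝓘(ℝ, E) 𝓘(ℝ, E') (f ∘ φ.symm) z a := congr($c3 a)
      rw [c1, c2, mfderiv_eq_fderiv] at c5
      exact c5
    rw [coordMetric_apply, coordMetric_apply, ← hψ, ← hφ, hinv]
    refine (congrArg₂ (innerAt E' (f (φ.symm z))) (c4 v) (c4 w)).trans ?_
    exact hiso (φ.symm z) _ _

end Charts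

/-! ### Curvature as a trilinear map. -/

/-- A continuous trilinear map, as a linear map. -/
def trilinearOfCLM {E F : Type*} [NormedAddCommGroup E] [NormedSpace ℝ E] [NormedAddCommGroup F]
    [NormedSpace ℝ F] (A : E →L[ℝ] E →L[ℝ] E →L[ℝ] F) : E →ₗ[ℝ] E →ₗ[ℝ] E →ₗ[ℝ] F :=
  LinearMap.mk₂ ℝ (fun u v => (A u v).toLinearMap) (by intros; ext; simp) (by intros; ext; simp)
    (by intros; ext; simp) (by intros; ext; simp)

theorem IsMetricAt.exists_trilinear {E : Type*} [NormedAddCommGroup E] [NormedSpace ℝ E]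
    [CompleteSpace E] {G : E → E →L[ℝ] E →L[ℝ] ℝ} {y : E} (h : IsMetricAt G y) :
    ∃ R : E →ₗ[ℝ] E →ₗ[ℝ] E →ₗ[ℝ] E, ∀ u v w, R u v w = coordCurvature G y u v w := by
  let P : E →ₗ[ℝ] E →ₗ[ℝ] E →ₗ[ℝ] E :=
    LinearMap.mk₂ ℝ (fun u v => (christoffelL G y u ∘L christoffelL G y v).toLinearMap)
      (by intros; ext; simp) (by intros; ext; simp) (by intros; ext; simp) (by intros; ext; simp)
  let Q := trilinearOfCLM (fderiv ℝ (christoffelL G) y)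
  refine ⟨Q - Q.flip + P - P.flip, fun u v w => ?_⟩
  rw [h.coordCurvature_eq]
  rfl

theorem exists_trilinear_transport {E T : Type*} [AddCommGroup E] [Module ℝ E] [AddCommGroup T]
    [Module ℝ T] (e : T ≃ₗ[ℝ] E) (R : E →ₗ[ℝ] E →ₗ[ℝ] E →ₗ[ℝ] E) :
    ∃ S : T →ₗ[ℝ] T →ₗ[ℝ] T →ₗ[ℝ] T, ∀ u v w, S u v w = e.symm (R (e u) (e v) (e w)) :=
  ⟨LinearMap.mk₂ ℝ (fun u v => e.symm.toLinearMap ∘ₗ R (e u) (e v) ∘ₗ e.toLinearMap)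
    (by intros; ext; simp) (by intros; ext; simp) (by intros; ext; simp) (by intros; ext; simp),
    fun _ _ _ => rfl⟩

/-! ### Transfer of curvature, second fundamental form and Gauss equation to manifolds. -/

section Manifold

variable {E : Type*} [NormedAddCommGroup E] [NormedSpace ℝ E] [FiniteDimensional ℝ E]
  {M : Type*} [TopologicalSpace M] [ChartedSpace E M] [IsManifold 𝓘(ℝ, E) ∞ M]
  [RiemannianBundle (fun x : M => TangentSpace 𝓘(ℝ, E) x)]
  {E' : Type*} [NormedAddCommGroup E'] [NormedSpace ℝ E'] [FiniteDimensional ℝ E']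
  {N : Type*} [TopologicalSpace N] [ChartedSpace E' N] [IsManifold 𝓘(ℝ, E') ∞ N]
  [RiemannianBundle (fun y : N => TangentSpace 𝓘(ℝ, E') y)]

theorem exists_curvature_trilinear
    [IsContMDiffRiemannianBundle 𝓘(ℝ, E) ∞ E (fun x : M => TangentSpace 𝓘(ℝ, E) x)] (x : M) :
    ∃ R : TangentSpace 𝓘(ℝ, E) x →ₗ[ℝ] TangentSpace 𝓘(ℝ, E) x →ₗ[ℝ]
      TangentSpace 𝓘(ℝ, E) x →ₗ[ℝ] TangentSpace 𝓘(ℝ, E) x,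
      ∀ u v w, R u v w = curvature x u v w := by
  obtain ⟨R, hR⟩ := (isMetricAt_coordMetric (E := E) x).exists_trilinear
  -- The identity map, used to read the coordinate curvature on the tangent space.
  let e : TangentSpace 𝓘(ℝ, E) x ≃ₗ[ℝ] E :=
    { toFun := fun v => v, invFun := fun v => v, map_add' := fun _ _ => rfl,
      map_smul' := fun _ _ => rfl, left_inv := fun _ => rfl, right_inv := fun _ => rfl }
  obtain ⟨S, hS⟩ := exists_trilinear_transport e R
  exact ⟨S, fun u v w => (hS u v w).trans (hR u v w)⟩

omit [FiniteDimensional ℝ E] [IsManifold 𝓘(ℝ, E) ∞ M] [FiniteDimensional ℝ E']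
  [IsManifold 𝓘(ℝ, E') ∞ N]
  [RiemannianBundle (fun x : M => TangentSpace 𝓘(ℝ, E) x)]
  [RiemannianBundle (fun y : N => TangentSpace 𝓘(ℝ, E') y)] in
theorem differential_eq {f : M → N} (hf : ContMDiff 𝓘(ℝ, E) 𝓘(ℝ, E') ∞ f) (x : M)
    (v : TangentSpace 𝓘(ℝ, E) x) :
    differential E E' f x v =
      fderiv ℝ (writtenInExtChartAt 𝓘(ℝ, E) 𝓘(ℝ, E') x f) (extChartAt 𝓘(ℝ, E) x x) v := by
  have h : MDifferentiableAt 𝓘(ℝ, E) 𝓘(ℝ, E') f x := hf.mdifferentiable (by simp) x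
  change mfderiv 𝓘(ℝ, E) 𝓘(ℝ, E') f x v = _
  rw [h.mfderiv, modelWithCornersSelf_coe, Set.range_id, fderivWithin_univ]
  rfl

omit [FiniteDimensional ℝ E] [IsManifold 𝓘(ℝ, E) ∞ M] [FiniteDimensional ℝ E']
  [IsManifold 𝓘(ℝ, E') ∞ N]
  [RiemannianBundle (fun x : M => TangentSpace 𝓘(ℝ, E) x)]
  [RiemannianBundle (fun y : N => TangentSpace 𝓘(ℝ, E') y)] in
theorem writtenInExtChartAt_self (f : M → N) (x : M) :
    writtenInExtChartAt 𝓘(ℝ, E) 𝓘(ℝ, E') x f (extChartAt 𝓘(ℝ, E) x x) =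
      extChartAt 𝓘(ℝ, E') (f x) (f x) := by
  simp [writtenInExtChartAt]

omit [FiniteDimensional ℝ E] [IsManifold 𝓘(ℝ, E) ∞ M] [FiniteDimensional ℝ E']
  [IsManifold 𝓘(ℝ, E') ∞ N] in
theorem secondFundamentalForm_eq {f : M → N} (hf : ContMDiff 𝓘(ℝ, E) 𝓘(ℝ, E') ∞ f) (x : M)
    (X Y : TangentSpace 𝓘(ℝ, E) x) :
    secondFundamentalForm E E' f x X Y =
      coordSecondFundamentalForm (coordMetric E x) (coordMetric E' (f x))
        (writtenInExtChartAt 𝓘(ℝ, E) 𝓘(ℝ, E') x f) (extChartAt 𝓘(ℝ, E) x x) X Y := by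
  simp only [secondFundamentalForm, coordSecondFundamentalForm, christoffelL_apply,
    writtenInExtChartAt_self]
  erw [differential_eq hf, differential_eq hf, differential_eq hf, ← christoffelL_apply]
  rfl

omit [FiniteDimensional ℝ E] [IsManifold 𝓘(ℝ, E) ∞ M] [FiniteDimensional ℝ E']
  [IsManifold 𝓘(ℝ, E') ∞ N] in
theorem exists_secondFundamentalForm_bilinear {f : M → N}
    (hf : ContMDiff 𝓘(ℝ, E) 𝓘(ℝ, E') ∞ f) (x : M) :
    ∃ B : TangentSpace 𝓘(ℝ, E) x →ₗ[ℝ] TangentSpace 𝓘(ℝ, E) x →ₗ[ℝ] TangentSpace 𝓘(ℝ, E') (f x),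
      ∀ X Y, B X Y = secondFundamentalForm E E' f x X Y := by
  have h : ∃ B : E →ₗ[ℝ] E →ₗ[ℝ] E', ∀ X Y, B X Y =
      coordSecondFundamentalForm (coordMetric E x) (coordMetric E' (f x))
        (writtenInExtChartAt 𝓘(ℝ, E) 𝓘(ℝ, E') x f) (extChartAt 𝓘(ℝ, E) x x) X Y := by
    refine ⟨LinearMap.mk₂ ℝ (coordSecondFundamentalForm (coordMetric E x) (coordMetric E' (f x))
      (writtenInExtChartAt 𝓘(ℝ, E) 𝓘(ℝ, E') x f) (extChartAt 𝓘(ℝ, E) x x)) ?_ ?_ ?_ ?_,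
      fun _ _ => rfl⟩ <;> intros <;> simp [coordSecondFundamentalForm, smul_sub] <;> abel
  obtain ⟨B, hB⟩ := h
  exact ⟨B, fun X Y => (hB X Y).trans (secondFundamentalForm_eq hf x X Y).symm⟩

variable [IsContMDiffRiemannianBundle 𝓘(ℝ, E) ∞ E (fun x : M => TangentSpace 𝓘(ℝ, E) x)]
  [IsContMDiffRiemannianBundle 𝓘(ℝ, E') ∞ E' (fun y : N => TangentSpace 𝓘(ℝ, E') y)]

/-- Second derivatives commute and both Levi-Civita connections are torsion-free. -/
theorem secondFundamentalForm_symm {f : M → N} (hf : ContMDiff 𝓘(ℝ, E) 𝓘(ℝ, E') ∞ f) (x : M)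
    (X Y : TangentSpace 𝓘(ℝ, E) x) :
    secondFundamentalForm E E' f x X Y = secondFundamentalForm E E' f x Y X := by
  have h1 := (isMetricAt_coordMetric (E := E) x).christoffelL_symm X Y
  have h2 := (isMetricAt_coordMetric (E := E') (f x)).christoffelL_symm
  have h3 := (contDiffAt_writtenInExtChartAt hf x).isSymmSndFDerivAt
    (by rw [minSmoothness_of_isRCLikeNormedField]; norm_cast) X Y
  rw [secondFundamentalForm_eq hf, secondFundamentalForm_eq hf]
  unfold coordSecondFundamentalForm
  rw [writtenInExtChartAt_self, h1, h2, h3]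

/-- The **Gauss equation** of an isometric immersion. -/
theorem gauss_equation {f : M → N} (hf : ContMDiff 𝓘(ℝ, E) 𝓘(ℝ, E') ∞ f)
    (hiso : ∀ (x : M) (v w : TangentSpace 𝓘(ℝ, E) x),
      ⟪differential E E' f x v, differential E E' f x w⟫_ℝ = ⟪v, w⟫_ℝ) (x : M)
    (u v w z : TangentSpace 𝓘(ℝ, E) x) :
    ⟪curvature x u v w, z⟫_ℝ =
      ⟪curvature (f x) (differential E E' f x u) (differential E E' f x v)
        (differential E E' f x w), differential E E' f x z⟫_ℝ +
      ⟪secondFundamentalForm E E' f x u z, secondFundamentalForm E E' f x v w⟫_ℝ -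
      ⟪secondFundamentalForm E E' f x v z, secondFundamentalForm E E' f x u w⟫_ℝ := by
  have h := (isIsometricAt_writtenInExtChartAt hf hiso x).gauss_equation u v w z
  simp only [← secondFundamentalForm_eq hf] at h
  simp only [← differential_eq hf] at h
  simp only [writtenInExtChartAt_self] at h
  -- All four pairings are taken at chart centres, where coordinate metrics are the actual inner
  -- products.
  refine (coordMetric_self (E := E) x (curvature x u v w) z).symm.trans (h.trans ?_)
  exact congrArg₂ (· - ·) (congrArg₂ (· + ·) (coordMetric_self (E := E') (f x) _ _)
    (coordMetric_self (E := E') (f x) _ _)) (coordMetric_self (E := E') (f x) _ _)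

end Manifold
end CRGeom

end

/-! ### The inequality and its equality case. -/

theorem mainTheorem4
    {E : Type*} [NormedAddCommGroup E] [NormedSpace ℝ E] [FiniteDimensional ℝ E]
    {M : Type*} [TopologicalSpace M] [ChartedSpace E M] [IsManifold 𝓘(ℝ, E) ∞ M]
    [RiemannianBundle (fun x : M => TangentSpace 𝓘(ℝ, E) x)]
    [IsContMDiffRiemannianBundle 𝓘(ℝ, E) ∞ E (fun x : M => TangentSpace 𝓘(ℝ, E) x)]
    {E' : Type*} [NormedAddCommGroup E'] [NormedSpace ℝ E'] [FiniteDimensional ℝ E']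
    {N : Type*} [TopologicalSpace N] [ChartedSpace E' N] [IsManifold 𝓘(ℝ, E') ∞ N]
    [RiemannianBundle (fun y : N => TangentSpace 𝓘(ℝ, E') y)]
    [IsContMDiffRiemannianBundle 𝓘(ℝ, E') ∞ E' (fun y : N => TangentSpace 𝓘(ℝ, E') y)]
    (J : CRGeom.AlmostHermitian E' N) (f : M → N) (d l : ℕ)
    (hf : CRGeom.IsCRSubmanifold E J f d l) (x : M) :
    -- the supremum `δ⁺` is a maximum
    IsGreatest (CRGeom.mutualCurvatureValues E' d l (f x)) (CRGeom.deltaPlus E' d l (f x)) ∧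
    CRGeom.mutualCurvature (CRGeom.complexDistribution E J f x)
        (CRGeom.complexDistribution E J f x)ᗮ ≤
      1 / 4 * ‖CRGeom.meanCurvature E E' f x ⊤‖ ^ 2 + CRGeom.deltaPlus E' d l (f x) ∧
    (CRGeom.mutualCurvature (CRGeom.complexDistribution E J f x)
        (CRGeom.complexDistribution E J f x)ᗮ =
      1 / 4 * ‖CRGeom.meanCurvature E E' f x ⊤‖ ^ 2 + CRGeom.deltaPlus E' d l (f x) ↔
      (∀ X ∈ CRGeom.complexDistribution E J f x, ∀ Y ∈ (CRGeom.complexDistribution E J f x)ᗮ,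
        CRGeom.secondFundamentalForm E E' f x X Y = 0) ∧
      CRGeom.meanCurvature E E' f x (CRGeom.complexDistribution E J f x) =
        CRGeom.meanCurvature E E' f x (CRGeom.complexDistribution E J f x)ᗮ ∧
      CRGeom.mutualCurvature
          ((CRGeom.complexDistribution E J f x).map (CRGeom.differential E E' f x))
          ((CRGeom.complexDistribution E J f x)ᗮ.map (CRGeom.differential E E' f x)) =
        CRGeom.deltaPlus E' d l (f x)) := by 
  have hiso : ∀ v w, ⟪CRGeom.differential E E' f x v, CRGeom.differential E E' f x w⟫_ℝ = ⟪v, w⟫_ℝ :=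
    hf.isometric x
  obtain ⟨R, hR⟩ := CRGeom.exists_curvature_trilinear (E := E) x
  obtain ⟨R', hR'⟩ := CRGeom.exists_curvature_trilinear (E := E') (f x)
  obtain ⟨B, hB⟩ := CRGeom.exists_secondFundamentalForm_bilinear (E := E) (E' := E') hf.contMDiff x
  have hBsymm : ∀ v w, B v w = B w v := fun v w => by
    rw [hB, hB, CRGeom.secondFundamentalForm_symm hf.contMDiff]
  have hgauss : ∀ u v w z, ⟪R u v w, z⟫_ℝ =
      ⟪R' (CRGeom.differential E E' f x u) (CRGeom.differential E E' f x v)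
        (CRGeom.differential E E' f x w), CRGeom.differential E E' f x z⟫_ℝ +
      ⟪B u z, B v w⟫_ℝ - ⟪B v z, B u w⟫_ℝ := fun u v w z => by
    simp only [hR, hR', hB]
    exact CRGeom.gauss_equation hf.contMDiff hf.isometric x u v w z
  have hmutual : ∀ V W, CRGeom.mutualCurvature (x := x) V W = CRGeom.mutualSum R V W :=
    fun V W => by simp only [CRGeom.mutualCurvature, CRGeom.mutualSum, hR]
  have hmutual' : ∀ V W, CRGeom.mutualCurvature (x := f x) V W = CRGeom.mutualSum R' V W :=
    fun V W => by simp only [CRGeom.mutualCurvature, CRGeom.mutualSum, hR']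
  have hmean : ∀ V, CRGeom.meanCurvature E E' f x V = CRGeom.traceOn B V :=
    fun V => by simp only [CRGeom.meanCurvature, CRGeom.traceOn, hB]
  set D := CRGeom.complexDistribution E J f x with hD
  have hDrank : Module.finrank ℝ D = d := hf.finrank_complexDistribution x
  have hDorth : Module.finrank ℝ Dᗮ = l := by
    have h1 := Submodule.finrank_add_finrank_orthogonal D
    have h2 : Module.finrank ℝ (TangentSpace 𝓘(ℝ, E) x) = d + l := hf.finrank_model
    omega
  have hframe := (CRGeom.isOrthonormalFrame_std D).map _ hiso
  have hframe' := (CRGeom.isOrthonormalFrame_std Dᗮ).map _ hiso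
  have hortho : D.map (CRGeom.differential E E' f x) ⟂ Dᗮ.map (CRGeom.differential E E' f x) := by
    rw [Submodule.isOrtho_iff_inner_eq]
    rintro _ ⟨v, hv, rfl⟩ _ ⟨w, hw, rfl⟩
    rw [hiso]
    exact Submodule.inner_right_of_mem_orthogonal hv hw
  have hrank := hframe.finrank_eq
  have hrank' := hframe'.finrank_eq
  rw [Fintype.card_fin] at hrank hrank'
  have hgreatest : IsGreatest (CRGeom.mutualCurvatureValues E' d l (f x))
      (CRGeom.deltaPlus E' d l (f x)) := by
    -- The images of `D` and `Dᗮ` are an admissible pair: they make the set of values nonempty here,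
    -- and compete for the maximum in `hle`.
    have := CRGeom.isGreatest_mutualSum R' d l
      ⟨_, _, hortho, hrank.trans hDrank, hrank'.trans hDorth⟩
    simpa only [CRGeom.deltaPlus, CRGeom.mutualCurvatureValues, hmutual'] using this
  refine ⟨hgreatest, ?_⟩
  have hle : CRGeom.mutualSum R' (D.map (CRGeom.differential E E' f x))
      (Dᗮ.map (CRGeom.differential E E' f x)) ≤ CRGeom.deltaPlus E' d l (f x) :=
    hgreatest.2 ⟨_, _, hortho, hrank.trans hDrank, hrank'.trans hDorth, hmutual' _ _⟩
  simpa only [hmutual, hmutual', hmean, hB] using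
    CRGeom.mutualSum_le_and_eq_iff hiso hBsymm hgauss D hle
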